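/- Let $X$ and $Z$ be real random variables on a common probability space, with $Z$ standard normal and independent of $X$, and let $Y = X + Z$. Let $\phi$ be the standard normal density and $P_X$ the law of $X$. For every $y \in \mathbb{R}$ let $$P_{X|Y=y}(dx) = \frac{\phi(y-x)\,P_X(dx)}{\int_{\mathbb{R}} \phi(y-x')\,P_X(dx')}$$ be the conditional law of $X$ given $Y=y$ provided by Bayes' formula, let $F_{X|Y=y}$ be its cumulative distribution function, and define the conditional median by $$\mathsf{m}(X|Y=y) = F_{X|Y=y}^{-1}\left(\tfrac12\right) = \inf\left\{x \in \mathbb{R} : \tfrac12 \le F_{X|Y=y}(x)\right\}.$$ Fix $a \in [0,1)$. Then $$\mathsf{m}(X|Y=y) = a y \quad \text{for all } y \in \mathbb{R}$$ if and only if $X \sim \mathcal{N}\left(0, \frac{a}{1-a}\right)$, where $\mathcal{N}(0,0)$ denotes the point mass at $0$. The same equivalence holds when $\mathsf{m}(X|Y=y)$ is computed from an arbitrary version of the regular conditional distribution of $X$ given $Y$ and the identity $\mathsf{m}(X|Y=y) = ay$ is required only for almost every $y$ with respect to the law of $Y$. -/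

import Mathlib

open MeasureTheory ProbabilityTheory
open scoped ENNReal NNReal

/-- The quantile function (generalized inverse of the cdf) of a law on `ℝ`:
`F⁻¹(p) = inf {x : p ≤ F(x)}`, for `p ∈ (0, 1)`. -/
noncomputable def quantile (ν : Measure ℝ) (p : ℝ) : ℝ :=
  sInf {x : ℝ | p ≤ cdf ν x}

/-- The density at `y` of `Y = X + Z`, where `Z` is standard normal and independent of `X ~ π`:
`f_Y(y) = ∫ φ(y - x) π(dx)`. (`gaussianPDF x 1 y` is `φ(y - x)`.) -/
noncomputable def obsDensity (π : Measure ℝ) (y : ℝ) : ℝ≥0∞ :=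
  ∫⁻ x, gaussianPDF x 1 y ∂π

/-- The conditional law of `X` given `Y = y`, where `Y = X + Z`, `Z` is standard normal and
independent of `X ~ π`. It is given by Bayes' formula for every real `y`:
`P_{X|Y=y}(dx) = φ(y - x) π(dx) / f_Y(y)`. -/
noncomputable def condLaw (π : Measure ℝ) (y : ℝ) : Measure ℝ :=
  (obsDensity π y)⁻¹ • π.withDensity (fun x => gaussianPDF x 1 y)

/-- The conditional median `m(X | Y = y)`, the value at `1/2` of the conditional quantile
function of `X ~ π` given `Y = X + Z = y`. -/
noncomputable def condMedian (π : Measure ℝ) (y : ℝ) : ℝ :=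
  quantile (condLaw π y) (1 / 2)

theorem measurable_gaussianPDF_swap :
    Measurable (fun q : ℝ × ℝ => gaussianPDF q.2 1 q.1) := by
  simp only [gaussianPDF, gaussianPDFReal]
  fun_prop

theorem obsDensity_pos (π : Measure ℝ) [IsProbabilityMeasure π] (y : ℝ) :
    obsDensity π y ≠ 0 := by
  intro h
  have hm : Measurable (fun x => gaussianPDF x 1 y) := by
    simp only [gaussianPDF, gaussianPDFReal]
    fun_prop
  rw [obsDensity, lintegral_eq_zero_iff hm] at h
  have : ∀ᵐ x ∂π, False := by
    filter_upwards [h] with x hx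
    exact (gaussianPDF_pos x one_ne_zero y).ne' hx
  obtain ⟨_, hf⟩ := this.exists
  exact hf

theorem obsDensity_ne_top (π : Measure ℝ) [IsProbabilityMeasure π] (y : ℝ) :
    obsDensity π y ≠ ∞ := by
  have hb : ∀ x, gaussianPDF x 1 y ≤ 1 := by
    intro x
    rw [gaussianPDF, ← ENNReal.ofReal_one]
    apply ENNReal.ofReal_le_ofReal
    rw [gaussianPDFReal]
    have h1 : (√(2 * Real.pi * ((1 : ℝ≥0) : ℝ)))⁻¹ ≤ 1 := by
      apply inv_le_one_of_one_le₀
      rw [Real.one_le_sqrt]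
      have := Real.pi_gt_three
      push_cast
      linarith
    have h2 : Real.exp (-(y - x) ^ 2 / (2 * ((1 : ℝ≥0) : ℝ))) ≤ 1 := by
      rw [Real.exp_le_one_iff]
      apply div_nonpos_of_nonpos_of_nonneg
      · nlinarith [sq_nonneg (y - x)]
      · positivity
    exact mul_le_one₀ h1 (Real.exp_pos _).le h2
  have : obsDensity π y ≤ 1 := by
    calc obsDensity π y ≤ ∫⁻ _, 1 ∂π := lintegral_mono hb
      _ = 1 := by simp
  exact (this.trans_lt ENNReal.one_lt_top).ne

instance isProbabilityMeasure_condLaw (π : Measure ℝ) [IsProbabilityMeasure π] (y : ℝ) :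
    IsProbabilityMeasure (condLaw π y) := by
  constructor
  rw [condLaw, Measure.smul_apply, withDensity_apply _ MeasurableSet.univ,
    Measure.restrict_univ, smul_eq_mul]
  exact ENNReal.inv_mul_cancel (obsDensity_pos π y) (obsDensity_ne_top π y)

theorem measurable_condLaw (π : Measure ℝ) [IsProbabilityMeasure π] :
    Measurable (condLaw π) := by
  refine Measure.measurable_of_measurable_coe _ fun s hs => ?_
  have h1 : ∀ μ : Measure ℝ, SFinite μ → Measurable fun y => ∫⁻ x, gaussianPDF x 1 y ∂μ :=
    fun μ _ => measurable_gaussianPDF_swap.lintegral_prod_right'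
  have h2 : (fun y => condLaw π y s)
      = fun y => (obsDensity π y)⁻¹ * ∫⁻ x in s, gaussianPDF x 1 y ∂π := by
    funext y
    rw [condLaw, Measure.smul_apply, withDensity_apply _ hs, smul_eq_mul]
  rw [h2]
  exact (h1 π inferInstance).inv.mul (h1 _ inferInstance)

theorem map_prod_apply_rect {Ω : Type*} [MeasurableSpace Ω] {P : Measure Ω}
    [IsProbabilityMeasure P] {X Z : Ω → ℝ} (hX : Measurable X) (hZ : Measurable Z)
    (hZlaw : P.map Z = gaussianReal 0 1) (hXZ : IndepFun X Z P) {s t : Set ℝ}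
    (hs : MeasurableSet s) (ht : MeasurableSet t) :
    P.map (fun ω => (X ω + Z ω, X ω)) (s ×ˢ t)
      = ∫⁻ y in s, ∫⁻ x in t, gaussianPDF x 1 y ∂(P.map X) := by
  have : IsProbabilityMeasure (P.map X) := Measure.isProbabilityMeasure_map hX.aemeasurable
  have h0 : P.map (fun ω => (X ω, Z ω)) = (P.map X).prod (gaussianReal 0 1) := by
    rw [← hZlaw]
    exact (indepFun_iff_map_prod_eq_prod_map_map hX.aemeasurable hZ.aemeasurable).1 hXZ
  have hg : Measurable (fun q : ℝ × ℝ => (q.1 + q.2, q.1)) := by fun_prop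
  have h1 : P.map (fun ω => (X ω + Z ω, X ω))
      = ((P.map X).prod (gaussianReal 0 1)).map (fun q : ℝ × ℝ => (q.1 + q.2, q.1)) := by
    rw [← h0, Measure.map_map hg (hX.prodMk hZ)]
    rfl
  rw [h1, Measure.map_apply hg (hs.prod ht), Measure.prod_apply (hg (hs.prod ht)),
    lintegral_lintegral_swap measurable_gaussianPDF_swap.aemeasurable,
    ← lintegral_indicator ht]
  refine lintegral_congr fun x => ?_
  by_cases hx : x ∈ t
  · rw [Set.indicator_of_mem hx]
    have e : Prod.mk x ⁻¹' ((fun q : ℝ × ℝ => (q.1 + q.2, q.1)) ⁻¹' s ×ˢ t)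
        = (fun z => x + z) ⁻¹' s := by
      ext z
      simp [hx]
    rw [e, ← Measure.map_apply (by fun_prop) hs, gaussianReal_map_const_add, zero_add,
      gaussianReal_apply _ one_ne_zero]
  · rw [Set.indicator_of_notMem hx]
    have e : Prod.mk x ⁻¹' ((fun q : ℝ × ℝ => (q.1 + q.2, q.1)) ⁻¹' s ×ˢ t) = ∅ := by
      ext z
      simp [hx]
    rw [e, measure_empty]

/-- Bayes' formula does define a version of the regular conditional distribution of `X`
given `Y = X + Z`. -/
theorem condDistrib_ae_eq_condLaw {Ω : Type*} [MeasurableSpace Ω] {P : Measure Ω}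
    [IsProbabilityMeasure P] {X Z : Ω → ℝ} (hX : Measurable X) (hZ : Measurable Z)
    (hZlaw : P.map Z = gaussianReal 0 1) (hXZ : IndepFun X Z P) :
    ∀ᵐ y ∂(P.map (fun ω => X ω + Z ω)),
      condDistrib X (fun ω => X ω + Z ω) P y = condLaw (P.map X) y := by
  have : IsProbabilityMeasure (P.map X) := Measure.isProbabilityMeasure_map hX.aemeasurable
  have hY : Measurable (fun ω => X ω + Z ω) := hX.add hZ
  have : IsProbabilityMeasure (P.map (fun ω => X ω + Z ω)) :=
    Measure.isProbabilityMeasure_map hY.aemeasurable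
  let κ : Kernel ℝ ℝ := ⟨condLaw (P.map X), measurable_condLaw (P.map X)⟩
  have : IsMarkovKernel κ := ⟨fun y => isProbabilityMeasure_condLaw (P.map X) y⟩
  have hm : Measurable (obsDensity (P.map X)) :=
    measurable_gaussianPDF_swap.lintegral_prod_right'
  have hYlaw : P.map (fun ω => X ω + Z ω) = volume.withDensity (obsDensity (P.map X)) := by
    ext s hs
    have h := map_prod_apply_rect hX hZ hZlaw hXZ hs MeasurableSet.univ
    rw [Measure.map_apply (hY.prodMk hX) (hs.prod MeasurableSet.univ)] at h
    rw [withDensity_apply _ hs, Measure.map_apply hY hs]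
    simp only [Measure.restrict_univ] at h
    rw [show (fun y => obsDensity (P.map X) y)
      = fun y => ∫⁻ x, gaussianPDF x 1 y ∂(P.map X) from rfl, ← h]
    congr 1
    ext ω
    simp
  refine condDistrib_ae_eq_of_measure_eq_compProd (κ := κ) _ hX.aemeasurable ?_
  refine Measure.ext_prod fun {s t} hs ht => ?_
  rw [map_prod_apply_rect hX hZ hZlaw hXZ hs ht, Measure.compProd_apply_prod hs ht, hYlaw,
    setLIntegral_withDensity_eq_setLIntegral_mul _ hm (κ.measurable_coe ht) hs]
  refine lintegral_congr fun y => ?_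
  change _ = obsDensity (P.map X) y * condLaw (P.map X) y t
  rw [condLaw, Measure.smul_apply, withDensity_apply _ ht, smul_eq_mul, ← mul_assoc,
    ENNReal.mul_inv_cancel (obsDensity_pos _ y) (obsDensity_ne_top _ y), one_mul]

/-! ### Quantiles: mass on either side, and the Gaussian median. -/

open Filter Topology


/-! Take `0 < a < 1` and put `t = a y`. That `t` is a median of the posterior says that `φ(t/a - x)
π(dx)` has equal mass on both sides of `t`. Completing the square, `φ(t/a - x) = C(t) w(x) exp(-(x -
t)²/(2a))` with `w(x) = exp(x²(1 - a)/(2a))`, so the reweighted measure `μ = w π` has balanced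
Gaussian windows at every centre. Differentiating the balance in `t` gives `μ = (r ∗ μ) dt`, where
`r` is the two-sided Rayleigh density (`eq_rayleigh_conv_of_balanced`). Thus the density of `μ` is a
nonnegative harmonic function of a random walk with symmetric steps of finite variance. Such a walk
on the line is recurrent, so the function is constant (`ae_eq_const_of_conv_eq`). Hence `μ` is a
multiple of Lebesgue measure and `π` is proportional to `1/w`, the required Gaussian.

For `a = 0` the tilt `exp(x y)` with `|y|` large would overweight any mass of `π` off the origin
(`measure_pos_side_eq_zero`). The converse is the Gaussian posterior `N(a y, a)`
(`condLaw_gaussianReal`). The law of `Y` has the same null sets as Lebesgue measure, so versions of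
the conditional law make no difference. -/

theorem quantile_set_bddBelow (ν : Measure ℝ) [IsProbabilityMeasure ν] {p : ℝ} (hp : 0 < p) :
    BddBelow {x : ℝ | p ≤ cdf ν x} := by
  obtain ⟨b, hb⟩ := ((tendsto_cdf_atBot ν).eventually (gt_mem_nhds hp)).exists
  refine ⟨b, fun x hx => ?_⟩
  by_contra! h
  exact absurd (hx.trans (monotone_cdf ν h.le)) (not_le.2 hb)

theorem quantile_set_nonempty (ν : Measure ℝ) [IsProbabilityMeasure ν] {p : ℝ} (hp : p < 1) :
    {x : ℝ | p ≤ cdf ν x}.Nonempty := by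
  obtain ⟨b, hb⟩ := ((tendsto_cdf_atTop ν).eventually (lt_mem_nhds hp)).exists
  exact ⟨b, hb.le⟩

/-- Right continuity of the cdf makes the infimum attained. -/
theorem le_cdf_quantile (ν : Measure ℝ) [IsProbabilityMeasure ν] {p : ℝ} (hp : p < 1) :
    p ≤ cdf ν (quantile ν p) := by
  by_contra! h
  have hr := ((cdf ν).right_continuous (quantile ν p)).eventually (gt_mem_nhds h)
  obtain ⟨b, hb, hb'⟩ := mem_nhdsGE_iff_exists_Ico_subset.1 hr
  have : b ≤ quantile ν p := by
    refine le_csInf (quantile_set_nonempty ν hp) fun x hx => ?_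
    by_contra! hxb
    rcases le_or_gt (quantile ν p) x with hq | hq
    · exact (show cdf ν x < p from hb' ⟨hq, hxb⟩).not_ge hx
    · exact absurd (le_trans hx (monotone_cdf ν hq.le)) (not_le.2 h)
  exact absurd hb (not_lt.2 this)

theorem measure_Iio_quantile_le (ν : Measure ℝ) [IsProbabilityMeasure ν] {p : ℝ} (hp : 0 < p) :
    ν (Set.Iio (quantile ν p)) ≤ ENNReal.ofReal p := by
  conv_lhs => rw [← measure_cdf ν]
  rw [StieltjesFunction.measure_Iio _ (tendsto_cdf_atBot ν), sub_zero]
  apply ENNReal.ofReal_le_ofReal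
  refine le_of_tendsto ((monotone_cdf ν).tendsto_leftLim _) ?_
  filter_upwards [self_mem_nhdsWithin] with x hx
  by_contra! h
  have hle : quantile ν p ≤ x := csInf_le (quantile_set_bddBelow ν hp) h.le
  have hlt : x < quantile ν p := by simpa only [measure_cdf, Set.mem_Iio] using hx
  exact hlt.not_ge hle

theorem le_measure_Iic_quantile (ν : Measure ℝ) [IsProbabilityMeasure ν] {p : ℝ} (hp : p < 1) :
    ENNReal.ofReal p ≤ ν (Set.Iic (quantile ν p)) := by
  rw [← ofReal_cdf]
  exact ENNReal.ofReal_le_ofReal (le_cdf_quantile ν hp)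

theorem quantile_eq_of_cdf_eq (ν : Measure ℝ) {p m : ℝ}
    (h1 : cdf ν m = p) (h2 : ∀ x < m, cdf ν x < p) : quantile ν p = m := by
  refine le_antisymm (csInf_le ⟨m, fun x hx => ?_⟩ h1.ge) (le_csInf ⟨m, h1.ge⟩ fun x hx => ?_)
  all_goals
    by_contra! h
    exact absurd hx (not_le.2 (h2 x h))

theorem gaussianReal_Iic_mean (m : ℝ) {v : ℝ≥0} (hv : v ≠ 0) :
    gaussianReal m v (Set.Iic m) = 2⁻¹ := by
  have := nullSingletonClass_gaussianReal (μ := m) hv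
  have hmap : (gaussianReal m v).map (fun x => 2 * m - x) = gaussianReal m v := by
    rw [gaussianReal_map_const_sub]
    congr 1
    ring
  have h1 : gaussianReal m v (Set.Iic m) = gaussianReal m v (Set.Ioi m) := by
    conv_lhs => rw [← hmap]
    rw [Measure.map_apply (by fun_prop) measurableSet_Iic, measure_congr Ioi_ae_eq_Ici]
    congr 1
    ext x
    simp only [Set.mem_preimage, Set.mem_Iic, Set.mem_Ici]
    constructor <;> intro h <;> linarith
  have h2 := measure_add_measure_compl (μ := gaussianReal m v) (measurableSet_Iic (a := m))
  rw [Set.compl_Iic, ← h1, measure_univ, ← two_mul] at h2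
  exact ENNReal.eq_inv_of_mul_eq_one_left (by rwa [mul_comm])

theorem quantile_gaussianReal_half (m : ℝ) {v : ℝ≥0} (hv : v ≠ 0) :
    quantile (gaussianReal m v) (1 / 2) = m := by
  have hc : cdf (gaussianReal m v) m = 1 / 2 := by
    rw [cdf_eq_real, measureReal_def, gaussianReal_Iic_mean m hv]
    simp
  refine quantile_eq_of_cdf_eq _ hc fun x hx => ?_
  rw [← hc, ← sub_pos]
  have h := (cdf (gaussianReal m v)).measure_Ioc x m
  rw [measure_cdf] at h
  rw [← ENNReal.ofReal_pos, ← h, pos_iff_ne_zero]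
  intro h0
  have h1 := gaussianReal_absolutelyContinuous' m hv h0
  rw [Real.volume_Ioc, ENNReal.ofReal_eq_zero] at h1
  linarith

/-! ### A Liouville theorem for symmetric random walks on the line. -/

/-- Gaussian bumps are almost subharmonic for an even kernel, up to second order. -/
theorem gaussian_bump_midpoint_le (ε x u : ℝ) :
    Real.exp (-ε * x ^ 2) ≤ (Real.exp (-ε * (x - u) ^ 2) + Real.exp (-ε * (x + u) ^ 2)) / 2
      + ε * u ^ 2 * Real.exp (-ε * x ^ 2) := by
  have h1 : Real.exp (-ε * (x - u) ^ 2)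
      = Real.exp (-ε * x ^ 2) * Real.exp (-ε * u ^ 2) * Real.exp (2 * ε * x * u) := by
    rw [← Real.exp_add, ← Real.exp_add]; congr 1; ring
  have h2 : Real.exp (-ε * (x + u) ^ 2)
      = Real.exp (-ε * x ^ 2) * Real.exp (-ε * u ^ 2) * Real.exp (-(2 * ε * x * u)) := by
    rw [← Real.exp_add, ← Real.exp_add]; congr 1; ring
  -- This is `cosh ≥ 1`: averaging over `±u` removes the first-order term.
  have h3 : 2 ≤ Real.exp (2 * ε * x * u) + Real.exp (-(2 * ε * x * u)) := by
    linarith [Real.add_one_le_exp (2 * ε * x * u), Real.add_one_le_exp (-(2 * ε * x * u))]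
  have h4 : 1 - ε * u ^ 2 ≤ Real.exp (-ε * u ^ 2) := by
    linarith [Real.add_one_le_exp (-ε * u ^ 2)]
  have hx := Real.exp_pos (-ε * x ^ 2)
  have hu := Real.exp_pos (-ε * u ^ 2)
  rw [h1, h2]
  nlinarith [mul_le_mul_of_nonneg_left h3 (mul_pos hx hu).le, mul_le_mul_of_nonneg_left h4 hx.le]

section Liouville

variable {p : ℝ → ℝ≥0∞}

/-- The midpoint bound is averaged over `u` with weight `p u`; evenness of `p` symmetrises the
convolution. With no first-order term, the loss is only `ε` times the second moment. -/
theorem gaussian_bump_le_conv (hp : Measurable p) (heven : ∀ u, p (-u) = p u)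
    (hp1 : ∫⁻ u, p u = 1) {ε : ℝ} (hε : 0 ≤ ε) (x : ℝ) :
    ENNReal.ofReal (Real.exp (-ε * x ^ 2)) ≤
      (∫⁻ t, p (x - t) * ENNReal.ofReal (Real.exp (-ε * t ^ 2)))
        + ENNReal.ofReal ε * (∫⁻ u, ENNReal.ofReal (u ^ 2) * p u)
          * ENNReal.ofReal (Real.exp (-ε * x ^ 2)) := by
  set ψ : ℝ → ℝ≥0∞ := fun t => ENNReal.ofReal (Real.exp (-ε * t ^ 2)) with hψ
  have hψm : Measurable ψ := by fun_prop
  have e1 : ∫⁻ t, p (x - t) * ψ t = ∫⁻ u, p u * ψ (x - u) := by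
    rw [← lintegral_sub_left_eq_self (fun t => p (x - t) * ψ t) x]
    simp
  have e2 : ∫⁻ u, p u * ψ (x - u) = ∫⁻ u, p u * ψ (x + u) := by
    rw [← lintegral_neg_eq_self]
    simp [heven]
  have e3 : ∫⁻ t, p (x - t) * ψ t = ∫⁻ u, p u * ((ψ (x - u) + ψ (x + u)) / 2) := by
    have : ∀ u, p u * ((ψ (x - u) + ψ (x + u)) / 2)
        = 2⁻¹ * (p u * ψ (x - u)) + 2⁻¹ * (p u * ψ (x + u)) := by
      intro u
      rw [ENNReal.div_eq_inv_mul]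
      ring
    simp_rw [this]
    rw [lintegral_add_left (by fun_prop), lintegral_const_mul _ (by fun_prop),
      lintegral_const_mul _ (by fun_prop), ← e2, ← e1, ← add_mul, ENNReal.inv_two_add_inv_two,
      one_mul]
  have e4 : ENNReal.ofReal ε * (∫⁻ u, ENNReal.ofReal (u ^ 2) * p u) * ψ x
      = ∫⁻ u, p u * (ENNReal.ofReal (ε * u ^ 2) * ψ x) := by
    rw [mul_assoc, mul_comm (∫⁻ u, ENNReal.ofReal (u ^ 2) * p u), ← mul_assoc,
      ← lintegral_const_mul _ (by fun_prop)]
    refine lintegral_congr fun u => ?_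
    rw [ENNReal.ofReal_mul hε]
    ring
  have e5 : ψ x = ∫⁻ u, p u * ψ x := by
    rw [lintegral_mul_const _ hp, hp1, one_mul]
  change ψ x ≤ _ + _ * _ * ψ x
  rw [e3, e4, ← lintegral_add_left (by fun_prop)]
  conv_lhs => rw [e5]
  refine lintegral_mono fun u => ?_
  simp only [← mul_add]
  gcongr
  have h2 : (2 : ℝ≥0∞) = ENNReal.ofReal 2 := by simp
  simp only [hψ]
  rw [← ENNReal.ofReal_add (by positivity) (by positivity), h2,
    ← ENNReal.ofReal_div_of_pos (by norm_num), ← ENNReal.ofReal_mul (by positivity),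
    ← ENNReal.ofReal_add (by positivity) (by positivity)]
  exact ENNReal.ofReal_le_ofReal (gaussian_bump_midpoint_le ε x u)

theorem lintegral_exp_neg_mul_sq {ε : ℝ} (hε : 0 < ε) :
    ∫⁻ t : ℝ, ENNReal.ofReal (Real.exp (-ε * t ^ 2)) = ENNReal.ofReal √(Real.pi / ε) := by
  rw [← ofReal_integral_eq_lintegral_ofReal (integrable_exp_neg_mul_sq hε)
    (ae_of_all _ fun _ => (Real.exp_pos _).le), integral_gaussian]

/-- A bounded superharmonic function of a centred random walk on the line with finite variance
is harmonic. -/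
theorem conv_eq_of_conv_le (hp : Measurable p) (heven : ∀ u, p (-u) = p u)
    (hp1 : ∫⁻ u, p u = 1) (hp2 : ∫⁻ u, ENNReal.ofReal (u ^ 2) * p u ≠ ∞)
    {f : ℝ → ℝ≥0∞} (hf : Measurable f) {M : ℝ≥0∞} (hM : M ≠ ∞) (hfM : ∀ t, f t ≤ M)
    (hsup : ∀ᵐ t, ∫⁻ x, p (x - t) * f x ≤ f t) :
    ∀ᵐ t, ∫⁻ x, p (x - t) * f x = f t := by
  set F : ℝ → ℝ≥0∞ := fun t => ∫⁻ x, p (x - t) * f x with hF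
  have hFm : Measurable F := by
    refine Measurable.lintegral_prod_right' (f := fun q : ℝ × ℝ => p (q.2 - q.1) * f q.2) ?_
    fun_prop
  set σ := ∫⁻ u, ENNReal.ofReal (u ^ 2) * p u with hσ
  set ψ : ℝ → ℝ → ℝ≥0∞ := fun ε t => ENNReal.ofReal (Real.exp (-ε * t ^ 2)) with hψ
  have hψm : ∀ ε, Measurable (ψ ε) := fun ε => by fun_prop
  -- The defect `f - F`, tested against a bump of width `1/√ε`, is at most of order `ε ∫ ψ ε`, hence
  -- `O(√ε)`. Tonelli moves the kernel from `f` onto the bump.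
  have key : ∀ ε > 0, ∫⁻ t, (f t - F t) * ψ ε t ≤ σ * M * ENNReal.ofReal (√Real.pi * √ε) := by
    intro ε hε
    have hψint : ∫⁻ t, f t * ψ ε t ≤ M * ENNReal.ofReal √(Real.pi / ε) := by
      rw [← lintegral_exp_neg_mul_sq hε, ← lintegral_const_mul _ (hψm ε)]
      exact lintegral_mono fun t => mul_le_mul_left (hfM t) _
    have hfin : ∫⁻ t, f t * ψ ε t ≠ ∞ :=
      (hψint.trans_lt (ENNReal.mul_lt_top hM.lt_top ENNReal.ofReal_lt_top)).ne
    have hFle : ∫⁻ t, F t * ψ ε t ≤ ∫⁻ t, f t * ψ ε t := by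
      refine lintegral_mono_ae ?_
      filter_upwards [hsup] with t ht
      exact mul_le_mul_left ht _
    have hFfin := (hFle.trans_lt hfin.lt_top).ne
    have hswap : ∫⁻ t, F t * ψ ε t = ∫⁻ x, f x * ∫⁻ t, p (x - t) * ψ ε t := by
      have : ∀ t, F t * ψ ε t = ∫⁻ x, p (x - t) * f x * ψ ε t := fun t => by
        rw [lintegral_mul_const _ (by fun_prop)]
      simp_rw [this]
      rw [lintegral_lintegral_swap (by fun_prop)]
      refine lintegral_congr fun x => ?_
      rw [← lintegral_const_mul _ (by fun_prop)]
      refine lintegral_congr fun t => ?_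
      ring
    have hle : ∫⁻ t, f t * ψ ε t
        ≤ (∫⁻ t, F t * ψ ε t) + ENNReal.ofReal ε * σ * ∫⁻ t, f t * ψ ε t := by
      rw [hswap, ← lintegral_const_mul _ (by fun_prop), ← lintegral_add_right _ (by fun_prop)]
      refine lintegral_mono fun x => ?_
      calc f x * ψ ε x ≤ f x * ((∫⁻ t, p (x - t) * ψ ε t) + ENNReal.ofReal ε * σ * ψ ε x) := by
            gcongr
            exact gaussian_bump_le_conv hp heven hp1 hε.le x
        _ = _ := by ring
    have hsplit : (∫⁻ t, F t * ψ ε t) + ∫⁻ t, (f t - F t) * ψ ε t = ∫⁻ t, f t * ψ ε t := by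
      rw [← lintegral_add_left (by fun_prop)]
      refine lintegral_congr_ae ?_
      filter_upwards [hsup] with t ht
      rw [← add_mul, add_tsub_cancel_of_le ht]
    conv_lhs at hle => rw [← hsplit]
    refine (ENNReal.le_of_add_le_add_left hFfin hle).trans ?_
    calc ENNReal.ofReal ε * σ * ∫⁻ t, f t * ψ ε t
        ≤ ENNReal.ofReal ε * σ * (M * ENNReal.ofReal √(Real.pi / ε)) := by gcongr
      _ = σ * M * (ENNReal.ofReal ε * ENNReal.ofReal √(Real.pi / ε)) := by ring
      _ = _ := by
        rw [← ENNReal.ofReal_mul hε.le, Real.sqrt_div Real.pi_pos.le]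
        congr 2
        have := Real.sqrt_pos.2 hε
        field_simp
        rw [Real.sq_sqrt hε.le]
  -- For `ε < 1` the bump `ψ ε` dominates the fixed positive weight `ψ 1`, so letting `ε → 0` kills
  -- the defect.
  have hzero : ∫⁻ t, (f t - F t) * ψ 1 t = 0 := by
    refine le_antisymm ?_ zero_le
    have hlim : Tendsto (fun ε : ℝ => σ * M * ENNReal.ofReal (√Real.pi * √ε)) (𝓝[>] 0) (𝓝 0) := by
      have h1 : Tendsto (fun ε : ℝ => ENNReal.ofReal (√Real.pi * √ε)) (𝓝[>] 0) (𝓝 0) := by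
        have : Continuous fun ε : ℝ => ENNReal.ofReal (√Real.pi * √ε) :=
          ENNReal.continuous_ofReal.comp (by fun_prop)
        simpa using (this.tendsto 0).mono_left nhdsWithin_le_nhds
      simpa using ENNReal.Tendsto.const_mul h1 (Or.inr (ENNReal.mul_ne_top hp2 hM))
    refine ge_of_tendsto hlim ?_
    filter_upwards [Ioo_mem_nhdsGT (zero_lt_one' ℝ)] with ε hε
    refine le_trans (lintegral_mono fun t => ?_) (key ε hε.1)
    refine mul_le_mul_right (ENNReal.ofReal_le_ofReal (Real.exp_le_exp.2 ?_)) _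
    nlinarith [hε.2, sq_nonneg t]
  rw [lintegral_eq_zero_iff (by fun_prop)] at hzero
  filter_upwards [hzero, hsup] with t ht hs
  refine le_antisymm hs (tsub_eq_zero_iff_le.1 ?_)
  refine (mul_eq_zero.1 ht).resolve_right ?_
  simp [hψ, Real.exp_pos]

/-- Liouville property: nonnegative harmonic functions of a centred random walk on the line with
finite variance and a positive density are constant. -/
theorem ae_eq_const_of_conv_eq (hp : Measurable p) (heven : ∀ u, p (-u) = p u)
    (hp1 : ∫⁻ u, p u = 1) (hp2 : ∫⁻ u, ENNReal.ofReal (u ^ 2) * p u ≠ ∞)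
    (hpos : ∀ᵐ u, p u ≠ 0) {h : ℝ → ℝ≥0∞} (hh : Measurable h)
    (hharm : ∀ᵐ t, ∫⁻ x, p (x - t) * h x = h t) :
    ∃ c, h =ᵐ[volume] fun _ => c := by
  have hp1' : ∀ t, ∫⁻ x, p (x - t) = 1 := fun t => by
    rw [lintegral_sub_right_eq_self p t, hp1]
  -- The truncation `min h M` is bounded and superharmonic, hence harmonic. If `h > M` on a non-null
  -- set, the truncation attains its maximum `M` at some `t` there; an average with positive weights
  -- that equals the maximum forces `min h M = M` almost everywhere.
  have dich : ∀ M : ℝ≥0∞, M ≠ ∞ → (∀ᵐ t, h t ≤ M) ∨ ∀ᵐ t, M ≤ h t := by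
    intro M hM
    rw [or_iff_not_imp_left]
    intro hnot
    have hmin : ∀ᵐ t, ∫⁻ x, p (x - t) * min (h x) M = min (h t) M := by
      refine conv_eq_of_conv_le hp heven hp1 hp2 (hh.min measurable_const) hM
        (fun t => min_le_right _ _) ?_
      filter_upwards [hharm] with t ht
      refine le_min ?_ ?_
      · rw [← ht]
        exact lintegral_mono fun x => mul_le_mul_right (min_le_left _ _) _
      · calc ∫⁻ x, p (x - t) * min (h x) M ≤ ∫⁻ x, p (x - t) * M :=
              lintegral_mono fun x => mul_le_mul_right (min_le_right _ _) _
          _ = M := by rw [lintegral_mul_const _ (by fun_prop), hp1', one_mul]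
    obtain ⟨t, ht, htM⟩ := ((Filter.not_eventually.1 hnot).and_eventually hmin).exists
    rw [min_eq_right (not_le.1 ht).le] at htM
    have heq : ∫⁻ x, p (x - t) * M = M := by
      rw [lintegral_mul_const _ (by fun_prop), hp1', one_mul]
    have hae : (fun x => p (x - t) * min (h x) M) =ᵐ[volume] fun x => p (x - t) * M := by
      refine ae_eq_of_ae_le_of_lintegral_le
        (ae_of_all _ fun x => mul_le_mul_right (min_le_right _ _) _) ?_ (by fun_prop) ?_
      · rw [htM]; exact hM
      · rw [htM, heq]
    have hfin : ∀ᵐ x, p (x - t) < ∞ :=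
      ae_lt_top (by fun_prop) (by rw [hp1']; exact ENNReal.one_ne_top)
    have hpos' : ∀ᵐ x, p (x - t) ≠ 0 :=
      (measurePreserving_sub_right volume t).quasiMeasurePreserving.ae hpos
    filter_upwards [hae, hfin, hpos'] with x hx h1 h2
    rw [ENNReal.mul_right_inj h2 h1.ne] at hx
    exact min_eq_right_iff.1 hx
  refine ⟨essSup h volume, ?_⟩
  have hge : ∀ᵐ t, essSup h volume ≤ h t := by
    rcases eq_or_ne (essSup h volume) 0 with h0 | h0
    · simp [h0]
    -- The levels increase strictly to the essential supremum, so they are finite even if it is `∞`,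
    -- and `h ≤ u n` cannot hold almost everywhere.
    obtain ⟨u, -, hu, hlim⟩ := exists_seq_strictMono_tendsto' (pos_iff_ne_zero.2 h0)
    have : ∀ n, ∀ᵐ t, u n ≤ h t := fun n => by
      refine (dich (u n) (hu n).2.ne_top).resolve_left fun hle => ?_
      exact absurd (essSup_le_of_ae_le _ hle) (not_le.2 (hu n).2)
    filter_upwards [ae_all_iff.2 this] with t ht
    exact le_of_tendsto' hlim ht
  filter_upwards [hge, ENNReal.ae_le_essSup h] with t h1 h2
  exact le_antisymm h2 h1

end Liouville

/-! ### The two-sided Rayleigh kernel and balanced measures. -/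

/-- The two-sided Rayleigh density `u ↦ |u| / (2a) * exp (-u² / (2a))`. -/
noncomputable def rayleighPDF (a u : ℝ) : ℝ≥0∞ :=
  ENNReal.ofReal (|u| / (2 * a) * Real.exp (-u ^ 2 / (2 * a)))

@[fun_prop]
theorem measurable_rayleighPDF (a : ℝ) : Measurable (rayleighPDF a) := by
  unfold rayleighPDF
  fun_prop

theorem rayleighPDF_neg (a u : ℝ) : rayleighPDF a (-u) = rayleighPDF a u := by
  simp [rayleighPDF]

theorem ae_rayleighPDF_ne_zero {a : ℝ} (ha : 0 < a) : ∀ᵐ u, rayleighPDF a u ≠ 0 := by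
  filter_upwards [compl_mem_ae_iff.2 (measure_singleton (0 : ℝ))] with u hu
  have hu' : 0 < |u| := abs_pos.2 hu
  rw [rayleighPDF]
  exact (ENNReal.ofReal_pos.2 (by positivity)).ne'

theorem integrable_abs_pow_mul_exp_neg_mul_sq {b : ℝ} (hb : 0 < b) (n : ℕ) :
    Integrable fun u : ℝ => |u| ^ n * Real.exp (-b * u ^ 2) := by
  have h := (integrable_rpow_mul_exp_neg_mul_sq hb (s := n)
    (by linarith [n.cast_nonneg (α := ℝ)])).abs
  refine h.congr (ae_of_all _ fun u => ?_)
  simp [abs_mul, Real.abs_exp]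

theorem lintegral_rayleighPDF {a : ℝ} (ha : 0 < a) : ∫⁻ u, rayleighPDF a u = 1 := by
  have hb : 0 < (2 * a)⁻¹ := by positivity
  have h0 : ∀ u : ℝ, |u| / (2 * a) * Real.exp (-u ^ 2 / (2 * a))
      = (2 * a)⁻¹ * (|u| ^ 1 * Real.exp (-(2 * a)⁻¹ * u ^ 2)) := fun u => by
    rw [show -u ^ 2 / (2 * a) = -(2 * a)⁻¹ * u ^ 2 by ring]
    ring
  simp only [rayleighPDF, h0]
  rw [← ofReal_integral_eq_lintegral_ofReal
    ((integrable_abs_pow_mul_exp_neg_mul_sq hb 1).const_mul _) (ae_of_all _ fun u => by positivity),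
    integral_const_mul]
  have h1 : ∫ u : ℝ, |u| ^ 1 * Real.exp (-(2 * a)⁻¹ * u ^ 2)
      = 2 * ∫ u in Set.Ioi (0 : ℝ), u ^ (1 : ℝ) * Real.exp (-(2 * a)⁻¹ * u ^ (2 : ℝ)) := by
    rw [← integral_comp_abs (f := fun u : ℝ => u ^ (1 : ℝ) * Real.exp (-(2 * a)⁻¹ * u ^ (2 : ℝ)))]
    simp
  rw [h1, integral_rpow_mul_exp_neg_mul_rpow (by norm_num) (by norm_num) hb]
  norm_num
  rw [Real.rpow_neg_one]
  field_simp

theorem lintegral_sq_mul_rayleighPDF_ne_top {a : ℝ} (ha : 0 < a) :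
    ∫⁻ u, ENNReal.ofReal (u ^ 2) * rayleighPDF a u ≠ ∞ := by
  have hb : 0 < (2 * a)⁻¹ := by positivity
  have h0 : ∀ u : ℝ, ENNReal.ofReal (u ^ 2) * rayleighPDF a u
      = ENNReal.ofReal ((2 * a)⁻¹ * (|u| ^ 3 * Real.exp (-(2 * a)⁻¹ * u ^ 2))) := fun u => by
    rw [rayleighPDF, ← ENNReal.ofReal_mul (sq_nonneg u),
      show -u ^ 2 / (2 * a) = -(2 * a)⁻¹ * u ^ 2 by ring, ← sq_abs u]
    congr 1
    ring
  simp only [h0]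
  exact ((integrable_abs_pow_mul_exp_neg_mul_sq hb 3).const_mul _).lintegral_lt_top.ne

/-- The distribution function of `rayleighPDF`. -/
noncomputable def rayleighCDF (a u : ℝ) : ℝ :=
  Real.exp (-min u 0 ^ 2 / (2 * a)) / 2 + (1 - Real.exp (-max u 0 ^ 2 / (2 * a))) / 2

theorem rayleighCDF_of_nonpos (a : ℝ) {u : ℝ} (hu : u ≤ 0) :
    rayleighCDF a u = Real.exp (-u ^ 2 / (2 * a)) / 2 := by
  simp [rayleighCDF, hu]

theorem rayleighCDF_of_nonneg (a : ℝ) {u : ℝ} (hu : 0 ≤ u) :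
    rayleighCDF a u = 1 - Real.exp (-u ^ 2 / (2 * a)) / 2 := by
  simp only [rayleighCDF, hu, inf_of_le_right, sup_of_le_left]
  norm_num
  ring

theorem hasDerivAt_rayleighCDF (a : ℝ) {u : ℝ} (hu : u ≠ 0) :
    HasDerivAt (rayleighCDF a) (|u| / (2 * a) * Real.exp (-u ^ 2 / (2 * a))) u := by
  have hE : HasDerivAt (fun u : ℝ => Real.exp (-u ^ 2 / (2 * a)) / 2)
      (Real.exp (-u ^ 2 / (2 * a)) * (-(2 * u) / (2 * a)) / 2) u := by
    have := (((hasDerivAt_pow 2 u).neg.div_const (2 * a)).exp).div_const 2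
    simpa using this
  rcases hu.lt_or_gt with h | h
  · refine (hE.congr_deriv ?_).congr_of_eventuallyEq ?_
    · rw [abs_of_neg h]; ring
    · filter_upwards [gt_mem_nhds h] with x hx using rayleighCDF_of_nonpos a hx.le
  · refine ((hE.const_sub 1).congr_deriv ?_).congr_of_eventuallyEq ?_
    · rw [abs_of_pos h]; ring
    · filter_upwards [lt_mem_nhds h] with x hx using rayleighCDF_of_nonneg a hx.le

theorem setLIntegral_rayleighPDF {a : ℝ} (ha : 0 < a) (x : ℝ) {s r : ℝ} (hsr : s ≤ r) :
    ∫⁻ t in Set.Ioc s r, rayleighPDF a (x - t)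
      = ENNReal.ofReal (rayleighCDF a (x - s) - rayleighCDF a (x - r)) := by
  have hcont : Continuous fun t : ℝ => |x - t| / (2 * a) * Real.exp (-(x - t) ^ 2 / (2 * a)) := by
    fun_prop
  have hint := hcont.intervalIntegrable (μ := volume) s r
  simp only [rayleighPDF]
  rw [← ofReal_integral_eq_lintegral_ofReal ((intervalIntegrable_iff_integrableOn_Ioc_of_le hsr).1 hint)
    (ae_of_all _ fun t => by positivity), ← intervalIntegral.integral_of_le hsr]
  congr 1
  -- The two branches of the distribution function meet at `t = x`; continuity there suffices, as
  -- one point may be excepted.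
  rw [integral_eq_of_hasDerivAt_off_countable_of_le (fun t => -rayleighCDF a (x - t)) _ hsr
    (Set.countable_singleton x) ?_ ?_ hint]
  · ring
  · have : Continuous (rayleighCDF a) := by unfold rayleighCDF; fun_prop
    fun_prop
  · intro t ht
    have hne : x - t ≠ 0 := sub_ne_zero.2 (Ne.symm ht.2)
    have := ((hasDerivAt_rayleighCDF a hne).comp t ((hasDerivAt_id t).const_sub x)).neg
    refine (this.congr_deriv ?_)
    ring

/-- The distribution function is the step `1_{u > 0}` plus half the window `exp(-u²/(2a))`, signed
`+` for `u ≤ 0` and `-` for `u > 0`. Subtract its values at `x - r` from those at `x - s`; negative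
terms change sides, since subtraction in `ℝ≥0∞` truncates. -/
theorem rayleighCDF_sub_identity {a : ℝ} (ha : 0 < a) {s r : ℝ} (hsr : s ≤ r) (x : ℝ) :
    2 * ENNReal.ofReal (rayleighCDF a (x - s) - rayleighCDF a (x - r))
      + ((Set.Ioi s).indicator (fun x => ENNReal.ofReal (Real.exp (-(x - s) ^ 2 / (2 * a)))) x
        + (Set.Iic r).indicator (fun x => ENNReal.ofReal (Real.exp (-(x - r) ^ 2 / (2 * a)))) x)
      = 2 * (Set.Ioc s r).indicator 1 x
      + ((Set.Iic s).indicator (fun x => ENNReal.ofReal (Real.exp (-(x - s) ^ 2 / (2 * a)))) x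
        + (Set.Ioi r).indicator (fun x => ENNReal.ofReal (Real.exp (-(x - r) ^ 2 / (2 * a)))) x) := by
  rw [show (2 : ℝ≥0∞) = ENNReal.ofReal 2 by simp]
  have hs := Real.exp_pos (-(x - s) ^ 2 / (2 * a))
  have hr := Real.exp_pos (-(x - r) ^ 2 / (2 * a))
  have hs1 : Real.exp (-(x - s) ^ 2 / (2 * a)) ≤ 1 :=
    Real.exp_le_one_iff.2 (div_nonpos_of_nonpos_of_nonneg (by nlinarith [sq_nonneg (x - s)])
      (by positivity))
  have hr1 : Real.exp (-(x - r) ^ 2 / (2 * a)) ≤ 1 :=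
    Real.exp_le_one_iff.2 (div_nonpos_of_nonpos_of_nonneg (by nlinarith [sq_nonneg (x - r)])
      (by positivity))
  rcases le_or_gt x s with h1 | h1
  · have hxr : x ≤ r := h1.trans hsr
    have hle : Real.exp (-(x - r) ^ 2 / (2 * a)) ≤ Real.exp (-(x - s) ^ 2 / (2 * a)) := by
      refine Real.exp_le_exp.2 (div_le_div_of_nonneg_right ?_ (by positivity))
      nlinarith
    rw [rayleighCDF_of_nonpos a (sub_nonpos.2 h1), rayleighCDF_of_nonpos a (sub_nonpos.2 hxr),
      ← ENNReal.ofReal_mul zero_le_two]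
    simp only [Set.mem_Ioi, h1.not_gt, not_false_eq_true, Set.indicator_of_notMem, Set.mem_Iic, hxr,
      Set.indicator_of_mem, h1, hxr.not_gt, Set.mem_Ioc, false_and, zero_add, mul_zero, add_zero]
    rw [← ENNReal.ofReal_add (by linarith) hr.le]
    congr 1
    ring
  rcases le_or_gt x r with h2 | h2
  · rw [rayleighCDF_of_nonneg a (sub_nonneg.2 h1.le), rayleighCDF_of_nonpos a (sub_nonpos.2 h2),
      ← ENNReal.ofReal_mul zero_le_two]
    simp only [Set.mem_Ioi, h1, h2, h1.not_ge, h2.not_gt, not_false_eq_true, Set.indicator_of_mem,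
      Set.indicator_of_notMem, Set.mem_Iic, Set.mem_Ioc, and_self, Pi.one_apply, mul_one, add_zero]
    rw [← ENNReal.ofReal_add hs.le hr.le, ← ENNReal.ofReal_add (by linarith) (by linarith)]
    congr 1
    ring
  · have hle : Real.exp (-(x - s) ^ 2 / (2 * a)) ≤ Real.exp (-(x - r) ^ 2 / (2 * a)) := by
      refine Real.exp_le_exp.2 (div_le_div_of_nonneg_right ?_ (by positivity))
      nlinarith
    rw [rayleighCDF_of_nonneg a (sub_nonneg.2 h1.le), rayleighCDF_of_nonneg a (sub_nonneg.2 h2.le),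
      ← ENNReal.ofReal_mul zero_le_two]
    simp only [Set.mem_Ioi, h1, h2, h1.not_ge, h2.not_ge, not_false_eq_true, Set.indicator_of_mem,
      Set.indicator_of_notMem, Set.mem_Iic, Set.mem_Ioc, and_false, mul_zero, add_zero, zero_add]
    rw [← ENNReal.ofReal_add (by linarith) hs.le]
    congr 1
    ring

/-- Integrating `rayleighCDF_sub_identity` against `μ`, the balance at `s` and at `r` makes the
window terms of the two sides equal. Being finite they cancel, which leaves the claim on `(s, r]`:
the integrated form of differentiating the balance in `t`. -/
theorem eq_rayleigh_conv_of_balanced {a : ℝ} (ha : 0 < a) (μ : Measure ℝ) [SFinite μ]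
    [IsLocallyFiniteMeasure μ]
    (hbal : ∀ t, ∫⁻ x in Set.Iic t, ENNReal.ofReal (Real.exp (-(x - t) ^ 2 / (2 * a))) ∂μ
      = ∫⁻ x in Set.Ioi t, ENNReal.ofReal (Real.exp (-(x - t) ^ 2 / (2 * a))) ∂μ)
    (hfin : ∀ t, ∫⁻ x in Set.Iic t, ENNReal.ofReal (Real.exp (-(x - t) ^ 2 / (2 * a))) ∂μ ≠ ∞) :
    μ = volume.withDensity fun t => ∫⁻ x, rayleighPDF a (x - t) ∂μ := by
  refine Measure.ext_of_Ioc _ _ fun s r hsr => ?_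
  rw [withDensity_apply _ measurableSet_Ioc, lintegral_lintegral_swap (by fun_prop)]
  simp_rw [setLIntegral_rayleighPDF ha _ hsr.le]
  have hm : ∀ t : ℝ, Measurable fun x : ℝ => ENNReal.ofReal (Real.exp (-(x - t) ^ 2 / (2 * a))) :=
    fun t => by fun_prop
  have hc : Measurable (rayleighCDF a) := by unfold rayleighCDF; fun_prop
  have h := lintegral_congr (μ := μ) (rayleighCDF_sub_identity ha hsr.le)
  have hi : Measurable ((Set.Ioc s r).indicator (1 : ℝ → ℝ≥0∞)) :=
    measurable_one.indicator measurableSet_Ioc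
  rw [lintegral_add_left (by fun_prop), lintegral_add_left (hi.const_mul _),
    lintegral_add_left ((hm s).indicator measurableSet_Ioi),
    lintegral_add_left ((hm s).indicator measurableSet_Iic),
    lintegral_indicator measurableSet_Ioi, lintegral_indicator measurableSet_Iic,
    lintegral_indicator measurableSet_Ioi, lintegral_indicator measurableSet_Iic,
    ← hbal s, ← hbal r, lintegral_const_mul _ (by fun_prop), lintegral_const_mul _ hi,
    lintegral_indicator_one measurableSet_Ioc] at h
  have h' := (ENNReal.add_left_inj (ENNReal.add_ne_top.2 ⟨hfin s, hfin r⟩)).1 h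
  exact ((ENNReal.mul_right_inj two_ne_zero (by simp)).1 h').symm

/-- A measure whose Gaussian windows are balanced on both sides of every centre is a multiple of
Lebesgue measure. -/
theorem eq_smul_volume_of_balanced {a : ℝ} (ha : 0 < a) (μ : Measure ℝ) [SFinite μ]
    [IsLocallyFiniteMeasure μ]
    (hbal : ∀ t, ∫⁻ x in Set.Iic t, ENNReal.ofReal (Real.exp (-(x - t) ^ 2 / (2 * a))) ∂μ
      = ∫⁻ x in Set.Ioi t, ENNReal.ofReal (Real.exp (-(x - t) ^ 2 / (2 * a))) ∂μ)
    (hfin : ∀ t, ∫⁻ x in Set.Iic t, ENNReal.ofReal (Real.exp (-(x - t) ^ 2 / (2 * a))) ∂μ ≠ ∞) :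
    ∃ c : ℝ≥0∞, μ = c • (volume : Measure ℝ) := by
  have hμ := eq_rayleigh_conv_of_balanced ha μ hbal hfin
  set h : ℝ → ℝ≥0∞ := fun t => ∫⁻ x, rayleighPDF a (x - t) ∂μ with hh
  have hm : Measurable h := by
    refine Measurable.lintegral_prod_right' (f := fun q : ℝ × ℝ => rayleighPDF a (q.2 - q.1)) ?_
    fun_prop
  -- Substituting `μ = h dx` into the integral that defines `h` makes `h` harmonic.
  have hharm : ∀ t, ∫⁻ x, rayleighPDF a (x - t) * h x = h t := fun t => by
    conv_rhs => rw [hh]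
    simp only
    conv_rhs => rw [hμ]
    rw [lintegral_withDensity_eq_lintegral_mul _ hm (by fun_prop)]
    exact lintegral_congr fun x => mul_comm _ _
  obtain ⟨c, hc⟩ := ae_eq_const_of_conv_eq (measurable_rayleighPDF a) (rayleighPDF_neg a)
    (lintegral_rayleighPDF ha) (lintegral_sq_mul_rayleighPDF_ne_top ha)
    (ae_rayleighPDF_ne_zero ha) hm (ae_of_all _ hharm)
  exact ⟨c, by rw [hμ, withDensity_congr_ae hc, withDensity_const]⟩

/-! ### From the conditional median to inequalities between half-line integrals. -/

@[fun_prop]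
theorem measurable_gaussianPDF_mean (y : ℝ) : Measurable fun x => gaussianPDF x 1 y := by
  simp only [gaussianPDF, gaussianPDFReal]
  fun_prop

theorem gaussianPDF_one_le_one (x y : ℝ) : gaussianPDF x 1 y ≤ 1 := by
  rw [gaussianPDF, ← ENNReal.ofReal_one]
  refine ENNReal.ofReal_le_ofReal (mul_le_one₀ (inv_le_one_of_one_le₀ ?_) (Real.exp_pos _).le ?_)
  · rw [Real.one_le_sqrt]
    push_cast
    linarith [Real.pi_gt_three]
  · exact Real.exp_le_one_iff.2
      (div_nonpos_of_nonpos_of_nonneg (neg_nonpos.2 (sq_nonneg _)) (by positivity))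

theorem condLaw_apply (π : Measure ℝ) (y : ℝ) {s : Set ℝ} (hs : MeasurableSet s) :
    condLaw π y s = (obsDensity π y)⁻¹ * ∫⁻ x in s, gaussianPDF x 1 y ∂π := by
  rw [condLaw, Measure.smul_apply, withDensity_apply _ hs, smul_eq_mul]

theorem setLIntegral_le_of_condLaw_le {π : Measure ℝ} [IsProbabilityMeasure π] {y : ℝ}
    {s t : Set ℝ} (hs : MeasurableSet s) (ht : MeasurableSet t)
    (h : condLaw π y s ≤ condLaw π y t) :
    ∫⁻ x in s, gaussianPDF x 1 y ∂π ≤ ∫⁻ x in t, gaussianPDF x 1 y ∂π := by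
  rw [condLaw_apply π y hs, condLaw_apply π y ht] at h
  exact (ENNReal.mul_le_mul_iff_right (ENNReal.inv_ne_zero.2 (obsDensity_ne_top π y))
    (ENNReal.inv_ne_top.2 (obsDensity_pos π y))).1 h

theorem ofReal_half : ENNReal.ofReal (1 / 2) = 2⁻¹ := by
  rw [one_div, ENNReal.ofReal_inv_of_pos two_pos, ENNReal.ofReal_ofNat]

/-- The median may be an atom, so only inequalities hold: this one and its mirror image below, each
with the closed half-line as the heavier. -/
theorem measure_Ioi_quantile_half_le (ν : Measure ℝ) [IsProbabilityMeasure ν] :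
    ν (Set.Ioi (quantile ν (1 / 2))) ≤ ν (Set.Iic (quantile ν (1 / 2))) := by
  have h := le_measure_Iic_quantile ν (p := 1 / 2) (by norm_num)
  refine le_trans ?_ h
  rw [← Set.compl_Iic, prob_compl_eq_one_sub measurableSet_Iic, ofReal_half]
  rw [ofReal_half] at h
  exact (tsub_le_tsub_left h 1).trans ENNReal.one_sub_inv_two.le

theorem measure_Iio_quantile_half_le (ν : Measure ℝ) [IsProbabilityMeasure ν] :
    ν (Set.Iio (quantile ν (1 / 2))) ≤ ν (Set.Ici (quantile ν (1 / 2))) := by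
  have h := measure_Iio_quantile_le ν (p := 1 / 2) (by norm_num)
  refine h.trans ?_
  rw [← Set.compl_Iio, prob_compl_eq_one_sub measurableSet_Iio, ofReal_half]
  rw [ofReal_half] at h
  exact ENNReal.one_sub_inv_two.ge.trans (tsub_le_tsub_left h 1)

/-- Lets laws be identified up to proportionality, without matching normalising constants. -/
theorem eq_of_eq_smul_of_isProbabilityMeasure {α : Type*} [MeasurableSpace α] {μ ν : Measure α}
    [IsProbabilityMeasure μ] [IsProbabilityMeasure ν] {c : ℝ≥0∞} (h : μ = c • ν) : μ = ν := by
  have h1 := congrArg (fun ρ : Measure α => ρ Set.univ) h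
  simp only [measure_univ, Measure.smul_apply, smul_eq_mul, mul_one] at h1
  rw [h, ← h1, one_smul]

/-! ### The case `a = 0`. -/

section Zero

/-- The sign `σ = ±1` covers both half-lines. As `σ y → ∞` the tilt `exp(x y)` stays at most `1` on
the far side, while on the near side its integral grows at least linearly in `σ y` unless `π` has no
mass there. -/
theorem measure_pos_side_eq_zero {π : Measure ℝ} [IsProbabilityMeasure π] {σ : ℝ} (hσ : σ ^ 2 = 1)
    (h : ∀ᵐ y : ℝ, ∫⁻ x in {x | 0 < σ * x}, gaussianPDF x 1 y ∂π
      ≤ ∫⁻ x in {x | 0 < σ * x}ᶜ, gaussianPDF x 1 y ∂π) :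
    π {x | 0 < σ * x} = 0 := by
  have hS : MeasurableSet {x : ℝ | 0 < σ * x} := measurableSet_lt measurable_const (by fun_prop)
  set c : ℝ := (√(2 * Real.pi * ((1 : ℝ≥0) : ℝ)))⁻¹ with hc
  have hcpos : 0 < c := by positivity
  have hpdf : ∀ y x : ℝ, gaussianPDF x 1 y
      = ENNReal.ofReal (c * Real.exp (-y ^ 2 / 2))
        * ENNReal.ofReal (Real.exp (x * y) * Real.exp (-x ^ 2 / 2)) := fun y x => by
    rw [gaussianPDF, gaussianPDFReal, ← ENNReal.ofReal_mul (by positivity), ← hc, mul_assoc,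
      ← Real.exp_add, ← Real.exp_add]
    congr 3
    push_cast
    ring
  have hbound : ∀ᵐ y : ℝ, 0 ≤ σ * y →
      ENNReal.ofReal (σ * y) * ∫⁻ x in {x | 0 < σ * x},
        ENNReal.ofReal (σ * x * Real.exp (-x ^ 2 / 2)) ∂π ≤ 1 := by
    filter_upwards [h] with y hy hσy
    simp_rw [hpdf y] at hy
    rw [lintegral_const_mul _ (by fun_prop), lintegral_const_mul _ (by fun_prop),
      ENNReal.mul_le_mul_iff_right (ENNReal.ofReal_pos.2 (by positivity)).ne' ENNReal.ofReal_ne_top]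
      at hy
    have hxy : ∀ x, x * y = σ * x * (σ * y) := fun x => by linear_combination (-x * y) * hσ
    calc _ = ∫⁻ x in {x | 0 < σ * x},
            ENNReal.ofReal (σ * y) * ENNReal.ofReal (σ * x * Real.exp (-x ^ 2 / 2)) ∂π := by
          rw [lintegral_const_mul _ (by fun_prop)]
      _ ≤ ∫⁻ x in {x | 0 < σ * x}, ENNReal.ofReal (Real.exp (x * y) * Real.exp (-x ^ 2 / 2)) ∂π := by
          refine lintegral_mono fun x => ?_
          rw [← ENNReal.ofReal_mul hσy, ← mul_assoc]
          refine ENNReal.ofReal_le_ofReal (mul_le_mul_of_nonneg_right ?_ (Real.exp_pos _).le)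
          linarith [Real.add_one_le_exp (x * y), hxy x]
      _ ≤ _ := hy
      _ ≤ ∫⁻ x in {x | 0 < σ * x}ᶜ, 1 ∂π := by
          refine setLIntegral_mono measurable_const fun x hx => ?_
          rw [← ENNReal.ofReal_one]
          refine ENNReal.ofReal_le_ofReal (mul_le_one₀ ?_ (Real.exp_pos _).le ?_)
          · rw [Real.exp_le_one_iff, hxy]
            exact mul_nonpos_of_nonpos_of_nonneg (not_lt.1 hx) hσy
          · rw [Real.exp_le_one_iff]
            nlinarith [sq_nonneg x]
      _ ≤ 1 := by
          rw [setLIntegral_one]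
          exact prob_le_one
  set I := ∫⁻ x in {x | 0 < σ * x}, ENNReal.ofReal (σ * x * Real.exp (-x ^ 2 / 2)) ∂π with hI
  have hsmall : ∀ n : ℕ, (n : ℝ≥0∞) * I ≤ 1 := by
    intro n
    -- The bound holds only for almost every `y`, so a large `y` is drawn from an open set of
    -- positive measure.
    have hpos : volume {y : ℝ | (n : ℝ) < σ * y} ≠ 0 := by
      have ho : IsOpen {y : ℝ | (n : ℝ) < σ * y} := isOpen_lt continuous_const (by fun_prop)
      refine (ho.measure_pos volume ⟨σ * (n + 1), ?_⟩).ne'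
      simp only [Set.mem_ofPred_eq]
      nlinarith
    obtain ⟨y, hy1, hy2⟩ := ((frequently_ae_iff.2 hpos).and_eventually hbound).exists
    have hn : (0 : ℝ) ≤ n := n.cast_nonneg
    refine le_trans ?_ (hy2 (hn.trans hy1.le))
    gcongr
    rw [← ENNReal.ofReal_natCast]
    exact ENNReal.ofReal_le_ofReal hy1.le
  have hI0 : I = 0 := by
    by_contra hne
    obtain ⟨n, hn⟩ := ENNReal.exists_nat_mul_gt hne ENNReal.one_ne_top
    exact absurd (hsmall n) (not_le.2 hn)
  rw [hI, setLIntegral_eq_zero_iff hS (by fun_prop)] at hI0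
  rw [measure_eq_zero_iff_ae_notMem]
  filter_upwards [hI0] with x hx hmem
  have := hx hmem
  rw [ENNReal.ofReal_eq_zero] at this
  exact absurd this (not_le.2 (mul_pos hmem (Real.exp_pos _)))

theorem eq_dirac_of_condMedian_eq_zero {π : Measure ℝ} [IsProbabilityMeasure π]
    (h : ∀ᵐ y : ℝ, condMedian π y = 0) : π = Measure.dirac 0 := by
  have h1 : π (Set.Ioi 0) = 0 := by
    have := measure_pos_side_eq_zero (π := π) (σ := 1) (by norm_num) (by
      filter_upwards [h] with y hy
      have := measure_Ioi_quantile_half_le (condLaw π y)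
      rw [← condMedian, hy] at this
      simpa [Set.Ioi, Set.Iic, Set.compl_ofPred] using
        setLIntegral_le_of_condLaw_le measurableSet_Ioi measurableSet_Iic this)
    simpa [Set.Ioi] using this
  have h2 : π (Set.Iio 0) = 0 := by
    have := measure_pos_side_eq_zero (π := π) (σ := -1) (by norm_num) (by
      filter_upwards [h] with y hy
      have := measure_Iio_quantile_half_le (condLaw π y)
      rw [← condMedian, hy] at this
      simpa [Set.Iio, Set.Ici, Set.compl_ofPred] using
        setLIntegral_le_of_condLaw_le measurableSet_Iio measurableSet_Ici this)
    simpa [Set.Iio] using this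
  have h0 : π ({0}ᶜ) = 0 := by
    rw [← Set.Iio_union_Ioi]
    exact measure_union_null h2 h1
  refine eq_of_eq_smul_of_isProbabilityMeasure (c := π {0}) ?_
  rw [← Measure.restrict_singleton, Measure.restrict_eq_self_of_ae_mem]
  exact mem_ae_iff.2 h0

end Zero

/-! ### The case `0 < a < 1`, and the Gaussian posterior. -/

section Positive

theorem tendsto_setLIntegral_of_eventually_mem_iff {π : Measure ℝ} [IsFiniteMeasure π]
    {l : Filter ℝ} [l.IsCountablyGenerated] {t₀ : ℝ} (hl : l ≤ 𝓝 t₀) {S : ℝ → Set ℝ}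
    (hS : ∀ t, MeasurableSet (S t)) (hSl : ∀ x, ∀ᶠ t in l, (x ∈ S t ↔ x ∈ S t₀))
    {F : ℝ → ℝ → ℝ≥0∞} (hFm : ∀ t, Measurable (F t)) (hF1 : ∀ t x, F t x ≤ 1)
    (hFc : ∀ x, Continuous fun t => F t x) :
    Tendsto (fun t => ∫⁻ x in S t, F t x ∂π) l (𝓝 (∫⁻ x in S t₀, F t₀ x ∂π)) := by
  simp_rw [← lintegral_indicator (hS _)]
  refine tendsto_lintegral_filter_of_dominated_convergence (fun _ => 1)
    (Eventually.of_forall fun t => (hFm t).indicator (hS t)) (Eventually.of_forall fun t =>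
      ae_of_all _ fun x => ?_) (by simp) (ae_of_all _ fun x => ?_)
  · exact Set.indicator_le (fun x _ => hF1 t x) x |>.trans le_rfl
  · by_cases hx : x ∈ S t₀
    · rw [Set.indicator_of_mem hx]
      refine (((hFc x).tendsto t₀).mono_left hl).congr' ?_
      filter_upwards [hSl x] with t ht
      rw [Set.indicator_of_mem (ht.2 hx)]
    · rw [Set.indicator_of_notMem hx]
      refine tendsto_const_nhds.congr' ?_
      filter_upwards [hSl x] with t ht
      rw [Set.indicator_of_notMem (mt ht.1 hx)]

/-- By dominated convergence both sides are right continuous in `t`, so equality almost everywhere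
spreads to every `t`. From the left this fails: an atom at `t` itself would change sides. -/
theorem setLIntegral_Iic_eq_Ioi_of_ae {π : Measure ℝ} [IsFiniteMeasure π]
    {F : ℝ → ℝ → ℝ≥0∞} (hFm : ∀ t, Measurable (F t)) (hF1 : ∀ t x, F t x ≤ 1)
    (hFc : ∀ x, Continuous fun t => F t x)
    (hae : ∀ᵐ t, ∫⁻ x in Set.Iic t, F t x ∂π = ∫⁻ x in Set.Ioi t, F t x ∂π) (t : ℝ) :
    ∫⁻ x in Set.Iic t, F t x ∂π = ∫⁻ x in Set.Ioi t, F t x ∂π := by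
  have hmem : ∀ x, ∀ᶠ s in 𝓝[>] t, (x ≤ s ↔ x ≤ t) := fun x => by
    rcases le_or_gt x t with hx | hx
    · filter_upwards [self_mem_nhdsWithin] with s hs
      exact iff_of_true (hx.trans (le_of_lt hs)) hx
    · filter_upwards [Ioo_mem_nhdsGT hx] with s hs
      exact iff_of_false hs.2.not_ge hx.not_ge
  have hA := tendsto_setLIntegral_of_eventually_mem_iff (π := π) (l := 𝓝[>] t) (S := Set.Iic)
    nhdsWithin_le_nhds (fun _ => measurableSet_Iic) hmem hFm hF1 hFc
  have hB := tendsto_setLIntegral_of_eventually_mem_iff (π := π) (l := 𝓝[>] t) (S := Set.Ioi)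
    nhdsWithin_le_nhds (fun _ => measurableSet_Ioi)
    (fun x => (hmem x).mono fun s hs => by simpa using not_congr hs) hFm hF1 hFc
  refine tendsto_nhds_unique_of_frequently_eq hA hB fun hne => ?_
  obtain ⟨b, hb, hsub⟩ := mem_nhdsGT_iff_exists_Ioo_subset.1 hne
  have hpos : volume (Set.Ioo t b) ≠ 0 := (isOpen_Ioo.measure_pos volume (Set.nonempty_Ioo.2 hb)).ne'
  obtain ⟨s, hs1, hs2⟩ := ((frequently_ae_iff.2 hpos).and_eventually hae).exists
  exact hsub hs1 hs2

theorem ae_div_of_ae {a : ℝ} (ha : a ≠ 0) {q : ℝ → Prop} (h : ∀ᵐ y, q y) : ∀ᵐ t, q (t / a) := by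
  have hq : Measure.QuasiMeasurePreserving (fun t : ℝ => t * a⁻¹) volume volume := by
    refine ⟨by fun_prop, ?_⟩
    rw [Real.map_volume_mul_right (inv_ne_zero ha)]
    exact Measure.smul_absolutelyContinuous
  simpa only [div_eq_mul_inv] using hq.ae h

theorem setLIntegral_Iic_eq_Ioi_of_condMedian_eq {π : Measure ℝ} [IsProbabilityMeasure π] {a : ℝ}
    (ha : a ≠ 0) (h : ∀ᵐ y : ℝ, condMedian π y = a * y) (t : ℝ) :
    ∫⁻ x in Set.Iic t, gaussianPDF x 1 (t / a) ∂π
      = ∫⁻ x in Set.Ioi t, gaussianPDF x 1 (t / a) ∂π := by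
  refine setLIntegral_Iic_eq_Ioi_of_ae (F := fun t x => gaussianPDF x 1 (t / a))
    (fun t => by fun_prop) (fun t x => gaussianPDF_one_le_one _ _) (fun x => ?_) ?_ t
  · simp only [gaussianPDF, gaussianPDFReal]
    exact ENNReal.continuous_ofReal.comp (by fun_prop)
  -- A finite measure has countably many atoms. Off them, open and closed half-lines agree and the
  -- two median inequalities combine into an equality.
  have hatom : ∀ᵐ t : ℝ, π {t} = 0 := by
    have := (Measure.countable_meas_level_set_pos (μ := π) (g := id) measurable_id).ae_notMem volume
    filter_upwards [this] with t ht
    simpa using ht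
  filter_upwards [ae_div_of_ae ha h, hatom] with t ht h0
  rw [mul_div_cancel₀ _ ha] at ht
  refine le_antisymm ?_ ?_
  · have := measure_Iio_quantile_half_le (condLaw π (t / a))
    rw [← condMedian, ht] at this
    have hle := setLIntegral_le_of_condLaw_le measurableSet_Iio measurableSet_Ici this
    rwa [setLIntegral_congr (Iio_ae_eq_Iic' h0), setLIntegral_congr (Ioi_ae_eq_Ici' h0).symm] at hle
  · have := measure_Ioi_quantile_half_le (condLaw π (t / a))
    rw [← condMedian, ht] at this
    exact setLIntegral_le_of_condLaw_le measurableSet_Ioi measurableSet_Iic this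

theorem eq_gaussianReal_of_condMedian_eq {π : Measure ℝ} [IsProbabilityMeasure π] {a : ℝ}
    (ha : 0 < a) (ha1 : a < 1) (h : ∀ᵐ y : ℝ, condMedian π y = a * y) :
    π = gaussianReal 0 (a / (1 - a)).toNNReal := by
  have h1a : 0 < 1 - a := sub_pos.2 ha1
  -- Completing the square: `-(t/a - x)²/2 = x²(1 - a)/(2a) - (x - t)²/(2a) - t²(1 - a)/(2a²)`.
  set w : ℝ → ℝ := fun x => Real.exp (x ^ 2 * (1 - a) / (2 * a)) with hw
  set w' : ℝ → ℝ := fun x => Real.exp (-(x ^ 2 * (1 - a) / (2 * a))) with hw'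
  set μ := π.withDensity fun x => ENNReal.ofReal (w x) with hμ
  have hlf : IsLocallyFiniteMeasure μ := .withDensity_ofReal (by fun_prop)
  set C : ℝ → ℝ := fun t => (√(2 * Real.pi * ((1 : ℝ≥0) : ℝ)))⁻¹
    * Real.exp (-(t ^ 2 * (1 - a) / (2 * a ^ 2))) with hC
  have hCpos : ∀ t, 0 < C t := fun t => by simp only [hC]; positivity
  have hpdf : ∀ t x, gaussianPDF x 1 (t / a) = ENNReal.ofReal (C t) *
      (ENNReal.ofReal (w x) * ENNReal.ofReal (Real.exp (-(x - t) ^ 2 / (2 * a)))) := fun t x => by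
    rw [gaussianPDF, gaussianPDFReal, ← ENNReal.ofReal_mul (Real.exp_pos _).le,
      ← ENNReal.ofReal_mul (hCpos t).le, ← Real.exp_add]
    simp only [hC]
    rw [mul_assoc (_⁻¹), ← Real.exp_add]
    congr 3
    push_cast
    field_simp
    ring
  have hset : ∀ (t : ℝ) {s : Set ℝ}, MeasurableSet s →
      ∫⁻ x in s, gaussianPDF x 1 (t / a) ∂π = ENNReal.ofReal (C t) *
        ∫⁻ x in s, ENNReal.ofReal (Real.exp (-(x - t) ^ 2 / (2 * a))) ∂μ := fun t s hs => by
    rw [setLIntegral_withDensity_eq_setLIntegral_mul _ (by fun_prop) (by fun_prop) hs,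
      ← lintegral_const_mul _ (by fun_prop)]
    exact lintegral_congr fun x => hpdf t x
  have hbal : ∀ t, ∫⁻ x in Set.Iic t, ENNReal.ofReal (Real.exp (-(x - t) ^ 2 / (2 * a))) ∂μ
      = ∫⁻ x in Set.Ioi t, ENNReal.ofReal (Real.exp (-(x - t) ^ 2 / (2 * a))) ∂μ := fun t => by
    have := setLIntegral_Iic_eq_Ioi_of_condMedian_eq ha.ne' h t
    rwa [hset t measurableSet_Iic, hset t measurableSet_Ioi,
      ENNReal.mul_right_inj (ENNReal.ofReal_pos.2 (hCpos t)).ne' ENNReal.ofReal_ne_top] at this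
  have hfin : ∀ t, ∫⁻ x in Set.Iic t, ENNReal.ofReal (Real.exp (-(x - t) ^ 2 / (2 * a))) ∂μ ≠ ∞ := by
    intro t htop
    have := hset t (measurableSet_Iic (a := t))
    rw [htop, ENNReal.mul_top (ENNReal.ofReal_pos.2 (hCpos t)).ne'] at this
    refine obsDensity_ne_top π (t / a) (top_le_iff.1 ?_)
    rw [← this]
    exact setLIntegral_le_lintegral _ _
  obtain ⟨c, hc⟩ := eq_smul_volume_of_balanced ha μ hbal hfin
  -- Undoing the weight: `w' = 1/w` is the unnormalised density of variance `a/(1 - a)`.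
  have hπ : π = c • (volume : Measure ℝ).withDensity fun x => ENNReal.ofReal (w' x) := by
    rw [← withDensity_smul_measure, ← hc, hμ, ← withDensity_mul _ (by fun_prop) (by fun_prop)]
    have : ((fun x => ENNReal.ofReal (w x)) * fun x => ENNReal.ofReal (w' x)) = 1 := by
      ext x
      simp only [Pi.mul_apply, Pi.one_apply, hw, hw']
      rw [← ENNReal.ofReal_mul (Real.exp_pos _).le, ← Real.exp_add]
      simp
    rw [this, withDensity_one]
  set v := (a / (1 - a)).toNNReal with hv
  have hvr : (v : ℝ) = a / (1 - a) := Real.coe_toNNReal _ (by positivity)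
  have hv0 : v ≠ 0 := by
    rw [← NNReal.coe_ne_zero, hvr]
    positivity
  set D : ℝ := (√(2 * Real.pi * v))⁻¹ with hD
  have hDpos : 0 < D := by
    have : (0 : ℝ) < v := by rw [hvr]; positivity
    positivity
  have hg : gaussianReal 0 v
      = ENNReal.ofReal D • (volume : Measure ℝ).withDensity fun x => ENNReal.ofReal (w' x) := by
    rw [gaussianReal_of_var_ne_zero _ hv0, ← withDensity_smul _ (by fun_prop)]
    congr 1
    ext x
    rw [gaussianPDF, gaussianPDFReal, Pi.smul_apply, smul_eq_mul, ← ENNReal.ofReal_mul hDpos.le]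
    simp only [hw']
    congr 3
    rw [hvr]
    field_simp
    ring
  refine eq_of_eq_smul_of_isProbabilityMeasure (c := c * (ENNReal.ofReal D)⁻¹) ?_
  rw [hg, smul_smul, mul_assoc, ENNReal.inv_mul_cancel (ENNReal.ofReal_pos.2 hDpos).ne'
    ENNReal.ofReal_ne_top, mul_one]
  exact hπ

/-- Gaussian conjugacy: prior variance `v = a/(1 - a)` and unit noise give posterior mean `y v/(1 +
v) = a y` and variance `v/(1 + v) = a`. -/
theorem condLaw_gaussianReal {a : ℝ} (ha : 0 < a) (ha1 : a < 1) (y : ℝ) :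
    condLaw (gaussianReal 0 (a / (1 - a)).toNNReal) y = gaussianReal (a * y) a.toNNReal := by
  have h1a : 0 < 1 - a := sub_pos.2 ha1
  set v := (a / (1 - a)).toNNReal with hv
  have hvr : (v : ℝ) = a / (1 - a) := Real.coe_toNNReal _ (by positivity)
  have hv0 : v ≠ 0 := by
    rw [← NNReal.coe_ne_zero, hvr]
    positivity
  have har : (a.toNNReal : ℝ) = a := Real.coe_toNNReal _ ha.le
  have ha0 : a.toNNReal ≠ 0 := by
    rw [← NNReal.coe_ne_zero, har]
    positivity
  have hvpos : (0 : ℝ) < v := by rw [hvr]; positivity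
  set K : ℝ := (√(2 * Real.pi * v))⁻¹ * (√(2 * Real.pi * ((1 : ℝ≥0) : ℝ)))⁻¹
    * √(2 * Real.pi * a) * Real.exp (-((1 - a) * y ^ 2 / 2)) with hK
  have hKpos : 0 < K := by positivity
  have hpt : (gaussianPDF 0 v * fun x => gaussianPDF x 1 y)
      = ENNReal.ofReal K • gaussianPDF (a * y) a.toNNReal := by
    ext x
    simp only [Pi.mul_apply, Pi.smul_apply, smul_eq_mul, gaussianPDF]
    rw [← ENNReal.ofReal_mul (gaussianPDFReal_nonneg _ _ _), ← ENNReal.ofReal_mul hKpos.le]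
    congr 1
    simp only [gaussianPDFReal, hK, har]
    have hs : √(2 * Real.pi * a) * (√(2 * Real.pi * a))⁻¹ = 1 :=
      mul_inv_cancel₀ (by positivity)
    have he : Real.exp (-(x - 0) ^ 2 / (2 * v)) * Real.exp (-(y - x) ^ 2 / (2 * ((1 : ℝ≥0) : ℝ)))
        = Real.exp (-((1 - a) * y ^ 2 / 2)) * Real.exp (-(x - a * y) ^ 2 / (2 * a)) := by
      rw [← Real.exp_add, ← Real.exp_add, hvr]
      congr 1
      push_cast
      field_simp
      ring
    linear_combination (√(2 * Real.pi * v))⁻¹ * (√(2 * Real.pi * ((1 : ℝ≥0) : ℝ)))⁻¹ * he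
      - (√(2 * Real.pi * v))⁻¹ * (√(2 * Real.pi * ((1 : ℝ≥0) : ℝ)))⁻¹
        * Real.exp (-((1 - a) * y ^ 2 / 2)) * Real.exp (-(x - a * y) ^ 2 / (2 * a)) * hs
  refine eq_of_eq_smul_of_isProbabilityMeasure
    (c := (obsDensity (gaussianReal 0 v) y)⁻¹ * ENNReal.ofReal K) ?_
  conv_lhs => rw [condLaw]
  rw [mul_smul]
  congr 1
  conv_lhs => rw [gaussianReal_of_var_ne_zero _ hv0]
  rw [gaussianReal_of_var_ne_zero _ ha0, ← withDensity_mul _ (by fun_prop) (by fun_prop), hpt,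
    withDensity_smul _ (by fun_prop)]

end Positive

/-! ### The converse, and passage to arbitrary versions. -/

theorem quantile_dirac (m : ℝ) : quantile (Measure.dirac m) (1 / 2) = m := by
  have h : ∀ x, (1 / 2 : ℝ) ≤ cdf (Measure.dirac m) x ↔ m ≤ x := fun x => by
    rw [cdf_eq_real, measureReal_def, Measure.dirac_apply' _ measurableSet_Iic]
    by_cases hx : m ≤ x
    · simp only [Set.mem_Iic, hx, Set.indicator_of_mem, Pi.one_apply, ENNReal.toReal_one, iff_true]
      norm_num
    · simp [hx]
  simp only [quantile, h]
  exact csInf_Ici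

theorem condMedian_gaussianReal {a : ℝ} (ha : a ∈ Set.Ico (0 : ℝ) 1) (y : ℝ) :
    condMedian (gaussianReal 0 (a / (1 - a)).toNNReal) y = a * y := by
  rcases ha.1.eq_or_lt with rfl | hpos
  · have : condLaw (Measure.dirac 0) y = Measure.dirac 0 := by
      refine eq_of_eq_smul_of_isProbabilityMeasure
        (c := (obsDensity (Measure.dirac 0) y)⁻¹ * gaussianPDF 0 1 y) ?_
      rw [condLaw, dirac_withDensity, smul_smul]
    simp only [zero_div, Real.toNNReal_zero, gaussianReal_zero_var, condMedian, this,
      quantile_dirac, zero_mul]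
  · rw [condMedian, condLaw_gaussianReal hpos ha.2]
    exact quantile_gaussianReal_half _ (Real.toNNReal_pos.2 hpos).ne'

theorem eq_gaussianReal_of_ae_condMedian_eq {π : Measure ℝ} [IsProbabilityMeasure π] {a : ℝ}
    (ha : a ∈ Set.Ico (0 : ℝ) 1) (h : ∀ᵐ y : ℝ, condMedian π y = a * y) :
    π = gaussianReal 0 (a / (1 - a)).toNNReal := by
  rcases ha.1.eq_or_lt with rfl | hpos
  · simp only [zero_mul] at h
    simpa using eq_dirac_of_condMedian_eq_zero h
  · exact eq_gaussianReal_of_condMedian_eq hpos ha.2 h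

theorem map_add_eq_withDensity_obsDensity {Ω : Type*} [MeasurableSpace Ω] {P : Measure Ω}
    [IsProbabilityMeasure P] {X Z : Ω → ℝ} (hX : Measurable X) (hZ : Measurable Z)
    (hZlaw : P.map Z = gaussianReal 0 1) (hXZ : IndepFun X Z P) :
    P.map (fun ω => X ω + Z ω) = volume.withDensity (obsDensity (P.map X)) := by
  have hY : Measurable fun ω => X ω + Z ω := hX.add hZ
  ext s hs
  have h := map_prod_apply_rect hX hZ hZlaw hXZ hs MeasurableSet.univ
  rw [Measure.map_apply (hY.prodMk hX) (hs.prod MeasurableSet.univ), Set.mk_preimage_prod,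
    Set.preimage_univ, Set.inter_univ, Measure.restrict_univ] at h
  rw [withDensity_apply _ hs, Measure.map_apply hY hs, h]
  rfl

/-- The density of `Y` is nowhere zero, so its law and Lebesgue measure have the same null sets. -/
theorem ae_map_add_iff_ae_volume {Ω : Type*} [MeasurableSpace Ω] {P : Measure Ω}
    [IsProbabilityMeasure P] {X Z : Ω → ℝ} (hX : Measurable X) (hZ : Measurable Z)
    (hZlaw : P.map Z = gaussianReal 0 1) (hXZ : IndepFun X Z P) {q : ℝ → Prop} :
    (∀ᵐ y ∂(P.map fun ω => X ω + Z ω), q y) ↔ ∀ᵐ y, q y := by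
  have : IsProbabilityMeasure (P.map X) := Measure.isProbabilityMeasure_map hX.aemeasurable
  have hm : Measurable (obsDensity (P.map X)) :=
    measurable_gaussianPDF_swap.lintegral_prod_right'
  rw [map_add_eq_withDensity_obsDensity hX hZ hZlaw hXZ, ae_withDensity_iff hm]
  simp [obsDensity_pos]

theorem mainTheorem1 {Ω : Type*} [MeasurableSpace Ω] (P : Measure Ω) [IsProbabilityMeasure P]
    (X Z : Ω → ℝ) (hX : Measurable X) (hZ : Measurable Z)
    (hZlaw : P.map Z = gaussianReal 0 1) (hXZ : IndepFun X Z P)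
    (a : ℝ) (ha : a ∈ Set.Ico (0 : ℝ) 1) :
    ((∀ y : ℝ, condMedian (P.map X) y = a * y) ↔
      P.map X = gaussianReal 0 (a / (1 - a)).toNNReal) ∧
    ((∀ᵐ y ∂(P.map (fun ω => X ω + Z ω)),
        quantile (condDistrib X (fun ω => X ω + Z ω) P y) (1 / 2) = a * y) ↔
      P.map X = gaussianReal 0 (a / (1 - a)).toNNReal) := by
  have : IsProbabilityMeasure (P.map X) := Measure.isProbabilityMeasure_map hX.aemeasurable
  refine ⟨⟨fun h => eq_gaussianReal_of_ae_condMedian_eq ha (ae_of_all _ h),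
    fun h y => h ▸ condMedian_gaussianReal ha y⟩, fun h => ?_, fun h => ?_⟩
  · refine eq_gaussianReal_of_ae_condMedian_eq ha
      ((ae_map_add_iff_ae_volume hX hZ hZlaw hXZ).1 ?_)
    filter_upwards [h, condDistrib_ae_eq_condLaw hX hZ hZlaw hXZ] with y h1 h2
    rwa [h2] at h1
  · filter_upwards [condDistrib_ae_eq_condLaw hX hZ hZlaw hXZ] with y hy
    rw [hy, h]
    exact condMedian_gaussianReal ha y
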